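/- Let $R$ be an associative ring with identity, let $R\text{-Mod}$ be the category of left $R$-modules and $\mathscr D(R)$ its (unbounded) derived category. Let $P^\bullet$ be a complex of projective $R$-modules with $P^n=0$ for all $n\in\mathbb Z\setminus\{-1,0\}$, and let $P^{\bullet\,\perp}$ be the full subcategory of $R\text{-Mod}$ consisting of the modules $X$ with $\operatorname{Hom}_{\mathscr D(R)}(P^\bullet,X[i])=0$ for all $i\in\mathbb Z$. Suppose that $\operatorname{Hom}_{\mathscr D(R)}(P^\bullet,P^{\bullet\,(\delta)}[1])=0$ for every cardinal $\delta$, where $P^{\bullet\,(\delta)}$ is the direct sum of $\delta$ copies of $P^\bullet$. Then the inclusion $j:P^{\bullet\,\perp}\to R\text{-Mod}$ has a left adjoint $l:R\text{-Mod}\to P^{\bullet\,\perp}$. Moreover, $l$ and the unit of the adjunction are given as follows. Let $M$ be an $R$-module. There is a family $(a_i)_{i\in I}$, indexed by a set $I$, of chain maps $a_i:P^\bullet\to M[1]$ whose classes generate $\operatorname{Hom}_{\mathscr D(R)}(P^\bullet,M[1])$ as a module over $\operatorname{End}_{\mathscr D(R)}(P^\bullet)$. For any such family, let $\omega:P^{\bullet\,(I)}\to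 M[1]$ be the chain map with components $a_i$, put $\overline M^\bullet:=\operatorname{cone}(\omega)[-1]$, and let $\varphi:M\to\overline M^\bullet$ be the chain map obtained by applying $[-1]$ to the canonical inclusion $M[1]\to\operatorname{cone}(\omega)$. Let $t$ be the trace of $H^0(P^\bullet)$ in $H^0(\overline M^\bullet)$, that is, the sum of the images of all homomorphisms $H^0(P^\bullet)\to H^0(\overline M^\bullet)$. Then there is an isomorphism $l(M)\cong H^0(\overline M^\bullet)/t$ under which the unit $M\to l(M)$ of the adjunction corresponds to the composite $$M\cong H^0(M)\xrightarrow{\,H^0(\varphi)\,}H^0(\overline M^\bullet)\longrightarrow H^0(\overline M^\bullet)/t .$$ -/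

import Mathlib

open CategoryTheory Limits

universe w u

noncomputable section

namespace TwoTermPerp

variable {R : Type u} [Ring R]

/-- The module `M`, regarded as a complex concentrated in degree `0`. -/
abbrev stalk (M : ModuleCat.{u} R) : CochainComplex (ModuleCat.{u} R) ℤ :=
  (CochainComplex.singleFunctor (ModuleCat.{u} R) 0).obj M

/-- `P` is a complex of projective modules whose terms vanish outside the degrees `-1` and `0`. -/
structure IsTwoTermProjective (P : CochainComplex (ModuleCat.{u} R) ℤ) : Prop where
  projective : ∀ n : ℤ, Module.Projective R (P.X n)
  isZero : ∀ n : ℤ, n ≠ -1 → n ≠ 0 → IsZero (P.X n)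

/-- The direct sum `P^(I)` of copies of the complex `P` indexed by `I`. -/
abbrev copower (P : CochainComplex (ModuleCat.{u} R) ℤ) (I : Type u) :
    CochainComplex (ModuleCat.{u} R) ℤ :=
  ∐ fun _ : I => P

/-- The perpendicular category of `P`: the modules `X` such that every morphism
`P ⟶ X[i]` in the derived category of `R` is zero, for every integer `i`. -/
def perp [HasDerivedCategory.{w} (ModuleCat.{u} R)] (P : CochainComplex (ModuleCat.{u} R) ℤ) :
    ObjectProperty (ModuleCat.{u} R) := fun X =>
  ∀ (i : ℤ) (f : DerivedCategory.Q.obj P ⟶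
    ((DerivedCategory.singleFunctor (ModuleCat.{u} R) 0).obj X)⟦i⟧), f = 0

/-- `Hom(P, P^(I)[1]) = 0` in the derived category of `R`, for every set `I`. -/
def SelfOrthogonal [HasDerivedCategory.{w} (ModuleCat.{u} R)]
    (P : CochainComplex (ModuleCat.{u} R) ℤ) : Prop :=
  ∀ (I : Type u) (f : DerivedCategory.Q.obj P ⟶
    (DerivedCategory.Q.obj (copower P I))⟦(1 : ℤ)⟧), f = 0

/-- The trace of the module `N` in the module `H`: the sum of the images of all
homomorphisms from `N` to `H`. -/
def traceIn (N H : ModuleCat.{u} R) : Submodule R H :=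
  ⨆ f : N ⟶ H, LinearMap.range f.hom

section Construction

variable {P : CochainComplex (ModuleCat.{u} R) ℤ} {M : ModuleCat.{u} R} {I : Type u}
  (a : I → (P ⟶ (stalk M)⟦(1 : ℤ)⟧))

/-- The classes of the chain maps `a i : P ⟶ M[1]` generate the group of morphisms `P ⟶ M[1]`
in the derived category as a module over the endomorphism ring of `P` in the derived category,
which acts by precomposition. -/
def Generates [HasDerivedCategory.{w} (ModuleCat.{u} R)] : Prop :=
  Submodule.span (End (DerivedCategory.Q.obj P))ᵐᵒᵖ
    (Set.range fun i =>
      (DerivedCategory.Q.map (a i) :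
        DerivedCategory.Q.obj P ⟶ DerivedCategory.Q.obj ((stalk M)⟦(1 : ℤ)⟧))) = ⊤

/-- The chain map `P^(I) ⟶ M[1]` with components `a i`. -/
def omega : copower P I ⟶ (stalk M)⟦(1 : ℤ)⟧ :=
  Sigma.desc a

/-- The complex `cone(ω)[-1]`, where `ω : P^(I) ⟶ M[1]` has the components `a i`. -/
def mBar : CochainComplex (ModuleCat.{u} R) ℤ :=
  (CochainComplex.mappingCone (omega a))⟦(-1 : ℤ)⟧

/-- The canonical chain map `M = M[1][-1] ⟶ cone(ω)[-1]`. -/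
def phi : stalk M ⟶ mBar a :=
  (shiftShiftNeg (stalk M) (1 : ℤ)).inv ≫
    (CochainComplex.mappingCone.inr (omega a))⟦(-1 : ℤ)⟧'

/-- The quotient of `H⁰(cone(ω)[-1])` by the trace of `H⁰(P)` in it. -/
def reflObj : ModuleCat.{u} R :=
  ModuleCat.of R ((mBar a).homology 0 ⧸ traceIn (P.homology 0) ((mBar a).homology 0))

/-- The canonical homomorphism `M ≅ H⁰(M) ⟶ H⁰(cone(ω)[-1]) ⟶ reflObj a`. -/
def reflUnit : M ⟶ reflObj a :=
  (HomologicalComplex.singleObjHomologySelfIso (ComplexShape.up ℤ) 0 M).inv ≫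
    HomologicalComplex.homologyMap (phi a) 0 ≫
      ModuleCat.ofHom (Submodule.mkQ (traceIn (P.homology 0) ((mBar a).homology 0)))

end Construction

end TwoTermPerp

end

/-!
Write `d : P⁻¹ ⟶ P⁰` for the differential of the two-term complex `P`. Since `P` is K-projective,
morphisms out of it in the derived category are homotopy classes of chain maps, so every hypothesis
and conclusion can be read off the components of `P`.

* A module `X` is perpendicular to `P` exactly when every morphism `P⁻¹ ⟶ X` extends uniquely along
  `d` (`perp_iff`).
* `H⁰(cone(ω)[-1])` is the pushout of `M` along `d^(I) : (P⁻¹)^(I) ⟶ (P⁰)^(I)`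
  (`isPushout_homology`). A map from `M` to a perpendicular module `X` therefore extends uniquely
  to `H⁰(cone(ω)[-1])`; since there is no nonzero map `H⁰(P) = coker d ⟶ X`, the extension kills the
  trace. This is the universal property (`existsUnique_reflUnit_comp_eq`).
* The quotient is perpendicular to `P` (`perp_reflObj`). For existence of extensions, lift a map
  from `P⁻¹` to `(P⁰)^(I) ⊕ M`; by self-orthogonality its first component is, modulo maps extending
  to `P⁰`, of the form `s ≫ d^(I)`, which the pushout relation moves into `M`, and a map `P⁻¹ ⟶ M`
  is dealt with by the generation hypothesis. For uniqueness, let `v : P⁰ ⟶ H⁰(cone(ω)[-1])` be such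
  that `d ≫ v` lands in the trace. As the trace is an image of some `(P⁰)^(J)` by a map killing
  `d^(J)`, self-orthogonality extends `d ≫ v` to a map `k` from `P⁰` into the trace, and `v - k`
  factors through `H⁰(P)`, so it lands in the trace as well.
-/

noncomputable section

namespace TwoTermPerp

/-! ### Morphisms from K-projective complexes in the derived category -/

section Derived

open DerivedCategory CochainComplex.HomComplex

universe v' u' w'

variable {C : Type u'} [Category.{v'} C] [Abelian C] [HasDerivedCategory.{w'} C]

lemma Q_map_surjective_of_isKProjective (K L : CochainComplex C ℤ) [K.IsKProjective] :
    Function.Surjective (Q.map : (K ⟶ L) → (Q.obj K ⟶ Q.obj L)) := by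
  intro f
  obtain ⟨g, hg⟩ := (CochainComplex.IsKProjective.Qh_map_bijective K
    ((HomotopyCategory.quotient _ _).obj L)).surjective
      ((quotientCompQhIso C).hom.app K ≫ f ≫ (quotientCompQhIso C).inv.app L)
  obtain ⟨g, rfl⟩ := (HomotopyCategory.quotient _ _).map_surjective g
  refine ⟨g, ?_⟩
  rw [← cancel_epi ((quotientCompQhIso C).hom.app K), ← quotientCompQhIso_hom_naturality, hg]
  simp

lemma Q_map_eq_zero_iff_of_isKProjective {K L : CochainComplex C ℤ} [K.IsKProjective]
    (f : K ⟶ L) : Q.map f = 0 ↔ Nonempty (Homotopy f 0) := by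
  rw [← HomotopyCategory.quotient_map_eq_zero_iff]
  have h := quotientCompQhIso_hom_naturality f
  constructor
  · intro hf
    apply (CochainComplex.IsKProjective.Qh_map_bijective K
      ((HomotopyCategory.quotient _ _).obj L)).injective
    rw [← cancel_mono ((quotientCompQhIso C).hom.app L), h, hf]
    simp
  · intro hf
    rw [← cancel_epi ((quotientCompQhIso C).hom.app K), ← h, hf]
    simp

/-- Vanishing of the morphisms `K ⟶ L[n]` in the derived category, for a K-projective complex `K`,
expressed in terms of the complex of morphisms from `K` to `L`. -/
lemma forall_shifted_hom_eq_zero_iff (K L : CochainComplex C ℤ) [K.IsKProjective] (n : ℤ) :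
    (∀ f : Q.obj K ⟶ (Q.obj L)⟦n⟧, f = 0) ↔
      ∀ z : Cocycle K L n, z ∈ coboundaries K L n := by
  have key (z : Cocycle K L n) :
      Q.map (Cocycle.equivHomShift.symm z) = 0 ↔ z ∈ coboundaries K L n := by
    rw [Q_map_eq_zero_iff_of_isKProjective, ← HomotopyCategory.quotient_map_eq_zero_iff,
      ← CohomologyClass.toHom_mk, CohomologyClass.toHom_mk_eq_zero_iff]
  constructor
  · intro h z
    rw [← key, ← cancel_mono ((Q.commShiftIso n).hom.app L)]
    exact (h _).trans zero_comp.symm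
  · intro h f
    obtain ⟨g, hg⟩ := Q_map_surjective_of_isKProjective K (L⟦n⟧)
      (f ≫ (Q.commShiftIso n).inv.app L)
    rw [← cancel_mono ((Q.commShiftIso n).inv.app L), ← hg, zero_comp,
      ← Cocycle.equivHomShift.symm_apply_apply g, key]
    exact h _

end Derived

/-! ### Two-term complexes of projectives -/

section TwoTerm

open DerivedCategory CochainComplex.HomComplex

variable {R : Type u} [Ring R] {P : CochainComplex (ModuleCat.{u} R) ℤ}

lemma IsTwoTermProjective.projective_X (hP : IsTwoTermProjective P) (n : ℤ) :
    Projective (P.X n) :=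
  (IsProjective.iff_projective (P.X n)).1 (hP.projective n)

lemma IsTwoTermProjective.isKProjective (hP : IsTwoTermProjective P) : P.IsKProjective := by
  have := hP.projective_X
  have : P.IsStrictlyLE 0 := by
    rw [CochainComplex.isStrictlyLE_iff]
    exact fun i hi => hP.isZero i (by lia) (by lia)
  exact CochainComplex.isKProjective_of_projective P 0

/-- A module is perpendicular to `P` exactly when it is orthogonal to the differential
`P⁻¹ ⟶ P⁰`. -/
lemma perp_iff [HasDerivedCategory.{w} (ModuleCat.{u} R)] (hP : IsTwoTermProjective P)
    (X : ModuleCat.{u} R) :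
    perp P X ↔ Function.Bijective fun g : P.X 0 ⟶ X => P.d (-1) 0 ≫ g := by
  have := hP.isKProjective
  have key : perp P X ↔ ∀ (p' p p'' : ℤ) (_ : p' + 1 = p) (_ : p + 1 = p'') (f : P.X p ⟶ X),
      P.d p' p ≫ f = 0 → ∃ g : P.X p'' ⟶ X, P.d p p'' ≫ g = f := by
    refine (forall_congr' fun i => forall_shifted_hom_eq_zero_iff P (stalk X) i).trans ?_
    constructor
    · intro h p' p p'' hp' hp'' f hf
      exact (Cocycle.toSingleMk_mem_coboundaries_iff f (show p + (-p) = 0 by lia) p' hp' hf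
        p'' hp'').1 (h _ _)
    · intro h i z
      obtain ⟨f, hf, rfl⟩ := Cocycle.toSingleMk_surjective z (-i) (by lia) (-i - 1) (by lia)
      exact (Cocycle.toSingleMk_mem_coboundaries_iff f _ _ _ hf (-i + 1) rfl).2
        (h _ _ _ (by lia) rfl f hf)
  rw [key]
  constructor
  · intro h
    refine ⟨fun g₁ g₂ hg => ?_, fun f => ?_⟩
    · obtain ⟨k, hk⟩ := h (-1) 0 1 (by lia) (by lia) (g₁ - g₂)
        (by simpa [sub_eq_zero] using hg)
      rw [← sub_eq_zero, ← hk, (hP.isZero 1 (by lia) (by lia)).eq_of_src k 0, comp_zero]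
    · exact h (-2) (-1) 0 (by lia) (by lia) f
        ((hP.isZero (-2) (by lia) (by lia)).eq_of_src _ _)
  · rintro ⟨h₁, h₂⟩ p' p p'' hp' hp'' f hf
    by_cases hp0 : p = 0
    · subst hp0
      obtain rfl : p' = -1 := by lia
      exact ⟨0, by simpa using (h₁ (a₁ := f) (a₂ := 0) (by simpa using hf)).symm⟩
    by_cases hp1 : p = -1
    · subst hp1
      obtain rfl : p'' = 0 := by lia
      exact h₂ f
    · exact ⟨0, (hP.isZero p hp1 hp0).eq_of_src _ _⟩

/-- A morphism `P⁻¹ ⟶ L⁻¹` extends by zero to a chain map when `P` is concentrated in the degrees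
`-1` and `0` and `L⁰ = 0`. -/
lemma exists_hom_of_isZero (hP : IsTwoTermProjective P)
    {L : CochainComplex (ModuleCat.{u} R) ℤ} (hL : IsZero (L.X 0)) (f : P.X (-1) ⟶ L.X (-1)) :
    ∃ φ : P ⟶ L, φ.f (-1) = f := by
  refine ⟨Cocycle.homOf (Cocycle.mk (Cochain.single f 0) 1 (by lia) ?_), ?_⟩
  · rw [Cochain.δ_single f 0 1 (by lia) (-2) 0 (by lia) (by lia),
      hL.eq_of_tgt (f ≫ _) 0,
      (hP.isZero (-2) (by lia) (by lia)).eq_of_src (_ ≫ f) 0]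
    simp
  · simp

/-- The degree `-1` component of a null-homotopic chain map out of a two-term complex. -/
lemma exists_f_eq_of_homotopy {L : CochainComplex (ModuleCat.{u} R) ℤ} {φ : P ⟶ L}
    (h : Homotopy φ 0) :
    ∃ (k : P.X 0 ⟶ L.X (-1)) (s : P.X (-1) ⟶ L.X (-2)),
      φ.f (-1) = P.d (-1) 0 ≫ k + s ≫ L.d (-2) (-1) := by
  refine ⟨h.hom 0 (-1), h.hom (-1) (-2), ?_⟩
  have := h.comm (-1)
  rw [dNext_eq _ (show (ComplexShape.up ℤ).Rel (-1) 0 by simp),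
    prevD_eq _ (show (ComplexShape.up ℤ).Rel (-2) (-1) by simp)] at this
  simpa using this

section Copower

variable (P) (I : Type u)

/-- The terms of `P^(I)` are coproducts of the terms of `P`. -/
def copowerXIsColimit (n : ℤ) :
    IsColimit (Cofan.mk ((copower P I).X n) fun i => (Sigma.ι (fun _ : I => P) i).f n) :=
  isColimitCofanMkObjOfIsColimit
    (HomologicalComplex.eval (ModuleCat.{u} R) (ComplexShape.up ℤ) n) _ _
    (coproductIsCoproduct fun _ : I => P)

variable {P I}

lemma copower_hom_ext {n : ℤ} {X : ModuleCat.{u} R} {f g : (copower P I).X n ⟶ X}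
    (h : ∀ i, (Sigma.ι (fun _ : I => P) i).f n ≫ f = (Sigma.ι (fun _ : I => P) i).f n ≫ g) :
    f = g :=
  Cofan.IsColimit.hom_ext (copowerXIsColimit P I n) _ _ h

lemma exists_copower_desc {n : ℤ} {X : ModuleCat.{u} R} (f : I → (P.X n ⟶ X)) :
    ∃ g : (copower P I).X n ⟶ X, ∀ i, (Sigma.ι (fun _ : I => P) i).f n ≫ g = f i :=
  ⟨Cofan.IsColimit.desc (copowerXIsColimit P I n) f,
    fun i => Cofan.IsColimit.fac (copowerXIsColimit P I n) f i⟩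

lemma isZero_copower_X {n : ℤ} (h : IsZero (P.X n)) : IsZero ((copower P I).X n) :=
  (IsZero.iff_id_eq_zero _).2 (copower_hom_ext fun _ => h.eq_of_src _ _)

end Copower

/-- `Hom(P, P^(I)[1]) = 0`, in terms of the components of `P`. -/
lemma SelfOrthogonal.exists_eq [HasDerivedCategory.{w} (ModuleCat.{u} R)]
    (horth : SelfOrthogonal P) (hP : IsTwoTermProjective P) (I : Type u)
    (f : P.X (-1) ⟶ (copower P I).X 0) :
    ∃ (k : P.X 0 ⟶ (copower P I).X 0) (s : P.X (-1) ⟶ (copower P I).X (-1)),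
      f = P.d (-1) 0 ≫ k + s ≫ (copower P I).d (-1) 0 := by
  have := hP.isKProjective
  obtain ⟨φ, hφ⟩ := exists_hom_of_isZero hP (L := (copower P I)⟦(1 : ℤ)⟧)
    (isZero_copower_X (hP.isZero 1 (by lia) (by lia))) f
  have h0 : Q.map φ = 0 := by
    rw [← cancel_mono ((Q.commShiftIso (1 : ℤ)).hom.app (copower P I))]
    exact (horth I _).trans zero_comp.symm
  obtain ⟨h⟩ := (Q_map_eq_zero_iff_of_isKProjective φ).1 h0
  have hd : ((copower P I)⟦(1 : ℤ)⟧).d (-2) (-1) = -(copower P I).d (-1) 0 := by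
    simp [CochainComplex.shiftFunctor_obj_d']
  obtain ⟨k, s, hks⟩ : ∃ (k : P.X 0 ⟶ (copower P I).X 0) (s : P.X (-1) ⟶ (copower P I).X (-1)),
      φ.f (-1) = P.d (-1) 0 ≫ k + s ≫ (-(copower P I).d (-1) 0) := by
    rw [← hd]
    exact exists_f_eq_of_homotopy h
  exact ⟨k, -s, by rw [← hφ, hks, Preadditive.comp_neg, Preadditive.neg_comp]⟩

end TwoTerm

/-! ### The zeroth cohomology of a complex with no differential out of degree zero -/

section HomologyZero

variable {R : Type u} [Ring R]

/-- The projection `K⁰ ⟶ H⁰(K)` of a complex `K` with vanishing differential `K⁰ ⟶ K¹`. -/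
def toHomologyZero (K : CochainComplex (ModuleCat.{u} R) ℤ) (hK : K.d 0 1 = 0) :
    K.X 0 ⟶ K.homology 0 :=
  K.pOpcycles 0 ≫ (K.isoHomologyι 0 1 (by simp) hK).inv

variable {K : CochainComplex (ModuleCat.{u} R) ℤ} (hK : K.d 0 1 = 0)

instance : Epi (toHomologyZero K hK) := by
  unfold toHomologyZero
  infer_instance

@[simp]
lemma d_toHomologyZero (i : ℤ) : K.d i 0 ≫ toHomologyZero K hK = 0 := by
  simp [toHomologyZero]

@[simp]
lemma d_toHomologyZero_assoc (i : ℤ) {X : ModuleCat.{u} R} (f : K.homology 0 ⟶ X) :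
    K.d i 0 ≫ toHomologyZero K hK ≫ f = 0 := by
  rw [← Category.assoc, d_toHomologyZero, zero_comp]

lemma exists_toHomologyZero_comp_eq {X : ModuleCat.{u} R} (f : K.X 0 ⟶ X)
    (hf : K.d (-1) 0 ≫ f = 0) : ∃ g : K.homology 0 ⟶ X, toHomologyZero K hK ≫ g = f :=
  ⟨K.homologyι 0 ≫ K.descOpcycles f (-1) (by simp) hf, by simp [toHomologyZero]⟩

/-- The map induced on `H⁰` by a chain map from a complex concentrated in degree `0`. -/
lemma singleObjHomologySelfIso_inv_homologyMap {M : ModuleCat.{u} R}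
    (φ : (HomologicalComplex.single (ModuleCat.{u} R) (ComplexShape.up ℤ) 0).obj M ⟶ K) :
    (HomologicalComplex.singleObjHomologySelfIso (ComplexShape.up ℤ) 0 M).inv ≫
        HomologicalComplex.homologyMap φ 0 =
      (HomologicalComplex.singleObjXSelf (ComplexShape.up ℤ) 0 M).inv ≫
        φ.f 0 ≫ toHomologyZero K hK := by
  rw [← cancel_mono (K.isoHomologyι 0 1 (by simp) hK).hom]
  simp [toHomologyZero, HomologicalComplex.singleObjOpcyclesSelfIso_hom]

end HomologyZero

/-! ### The zeroth cohomology of a shifted cone as a pushout -/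

section Cone

open CochainComplex

variable {R : Type u} [Ring R] {F L : CochainComplex (ModuleCat.{u} R) ℤ} (ω : F ⟶ L)

/-- The complex `cone(ω)[-1]`. -/
def coneShift : CochainComplex (ModuleCat.{u} R) ℤ :=
  (mappingCone ω)⟦(-1 : ℤ)⟧

/-- The terms of `cone(ω)[-1]` in terms of those of `cone(ω)`. -/
def coneShiftXIso (n m : ℤ) (h : m = n + -1) : (coneShift ω).X n ≅ (mappingCone ω).X m :=
  shiftFunctorObjXIso (mappingCone ω) (-1) n m h

lemma coneShiftXIso_inv_d : (coneShiftXIso ω (-1) (-2) (by lia)).inv ≫ (coneShift ω).d (-1) 0 =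
    -((mappingCone ω).d (-2) (-1) ≫ (coneShiftXIso ω 0 (-1) (by lia)).inv) := by
  have hd : (coneShift ω).d (-1) 0 = -(mappingCone ω).d (-2) (-1) := by
    simp [coneShift, shiftFunctor_obj_d']
  rw [hd]
  refine (Category.id_comp _).trans ?_
  exact congrArg Neg.neg (Category.comp_id _).symm

/-- The inclusion of the summand `F⁰` in the degree `0` term of `cone(ω)[-1]`. -/
def coneShiftInl : F.X 0 ⟶ (coneShift ω).X 0 :=
  (mappingCone.inl ω).v 0 (-1) (by lia) ≫ (coneShiftXIso ω 0 (-1) (by lia)).inv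

/-- The inclusion of the summand `L⁻¹` in the degree `0` term of `cone(ω)[-1]`. -/
def coneShiftInr : L.X (-1) ⟶ (coneShift ω).X 0 :=
  (mappingCone.inr ω).f (-1) ≫ (coneShiftXIso ω 0 (-1) (by lia)).inv

variable {ω} in
lemma coneShift_hom_ext {X : ModuleCat.{u} R} {f g : (coneShift ω).X 0 ⟶ X}
    (h₁ : coneShiftInl ω ≫ f = coneShiftInl ω ≫ g)
    (h₂ : coneShiftInr ω ≫ f = coneShiftInr ω ≫ g) : f = g := by
  rw [← cancel_epi (coneShiftXIso ω 0 (-1) (by lia)).inv]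
  refine mappingCone.ext_from ω 0 (-1) (by lia) ?_ ?_
  · simpa [coneShiftInl] using h₁
  · simpa [coneShiftInr] using h₂

lemma exists_coneShift_desc {X : ModuleCat.{u} R} (f : F.X 0 ⟶ X) (g : L.X (-1) ⟶ X) :
    ∃ h : (coneShift ω).X 0 ⟶ X, coneShiftInl ω ≫ h = f ∧ coneShiftInr ω ≫ h = g := by
  refine ⟨(coneShiftXIso ω 0 (-1) (by lia)).hom ≫
    ((mappingCone.fst ω).1.v (-1) 0 (by lia) ≫ f +
      (mappingCone.snd ω).v (-1) (-1) (by lia) ≫ g), ?_, ?_⟩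
  · simp [coneShiftInl]
  · simp [coneShiftInr]

/-- The differential of `cone(ω)[-1]` into degree `0`, on the summand `F⁻¹`. -/
lemma inl_coneShift_d :
    (mappingCone.inl ω).v (-1) (-2) (by lia) ≫
      (coneShiftXIso ω (-1) (-2) (by lia)).inv ≫ (coneShift ω).d (-1) 0 =
      F.d (-1) 0 ≫ coneShiftInl ω - ω.f (-1) ≫ coneShiftInr ω := by
  rw [coneShiftXIso_inv_d, Preadditive.comp_neg, ← Category.assoc,
    mappingCone.inl_v_d ω (-1) (-2) 0 (by lia) (by lia)]
  simp [coneShiftInl, coneShiftInr]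

lemma coneShift_d_comp_eq_zero (hL : IsZero (L.X (-2))) {X : ModuleCat.{u} R}
    (f : (coneShift ω).X 0 ⟶ X)
    (hf : F.d (-1) 0 ≫ coneShiftInl ω ≫ f = ω.f (-1) ≫ coneShiftInr ω ≫ f) :
    (coneShift ω).d (-1) 0 ≫ f = 0 := by
  rw [← cancel_epi (coneShiftXIso ω (-1) (-2) (by lia)).inv]
  refine mappingCone.ext_from ω (-1) (-2) (by lia) ?_ (hL.eq_of_src _ _)
  have := inl_coneShift_d ω =≫ f
  simp only [Category.assoc, Preadditive.sub_comp, hf, sub_self] at this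
  simpa using this

lemma coneShift_d_zero_one (hF : IsZero (F.X 1)) (hL : IsZero (L.X 0)) :
    (coneShift ω).d 0 1 = 0 :=
  IsZero.eq_of_tgt ((mappingCone.isZero_X_iff ω 0).2 ⟨hF, hL⟩) _ _

/-- If `L⁻² = 0` and `cone(ω)[-1]` has no differential out of degree `0`, then `H⁰(cone(ω)[-1])` is
the pushout of `L⁻¹` along the differential `F⁻¹ ⟶ F⁰`. -/
lemma isPushout_coneShift_homology (hL : IsZero (L.X (-2))) (h : (coneShift ω).d 0 1 = 0) :
    IsPushout (F.d (-1) 0) (ω.f (-1)) (coneShiftInl ω ≫ toHomologyZero (coneShift ω) h)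
      (coneShiftInr ω ≫ toHomologyZero (coneShift ω) h) := by
  have w : F.d (-1) 0 ≫ coneShiftInl ω ≫ toHomologyZero (coneShift ω) h =
      ω.f (-1) ≫ coneShiftInr ω ≫ toHomologyZero (coneShift ω) h := by
    rw [← sub_eq_zero, ← Category.assoc, ← Category.assoc, ← Preadditive.sub_comp,
      ← inl_coneShift_d]
    simp
  have hdesc (s : PushoutCocone (F.d (-1) 0) (ω.f (-1))) :
      ∃ g : (coneShift ω).homology 0 ⟶ s.pt,
        (coneShiftInl ω ≫ toHomologyZero (coneShift ω) h) ≫ g = s.inl ∧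
          (coneShiftInr ω ≫ toHomologyZero (coneShift ω) h) ≫ g = s.inr := by
    obtain ⟨k, h₁, h₂⟩ := exists_coneShift_desc ω s.inl s.inr
    obtain ⟨g, hg⟩ := exists_toHomologyZero_comp_eq h k
      (coneShift_d_comp_eq_zero ω hL k (by rw [h₁, h₂, s.condition]))
    exact ⟨g, by simp [hg, h₁], by simp [hg, h₂]⟩
  refine ⟨⟨w⟩, ⟨PushoutCocone.IsColimit.mk w (fun s => (hdesc s).choose)
    (fun s => (hdesc s).choose_spec.1) (fun s => (hdesc s).choose_spec.2) ?_⟩⟩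
  intro s m h₁ h₂
  rw [← cancel_epi (toHomologyZero (coneShift ω) h)]
  refine coneShift_hom_ext ?_ ?_
  · simpa using h₁.trans (hdesc s).choose_spec.1.symm
  · simpa using h₂.trans (hdesc s).choose_spec.2.symm

end Cone

/-! ### The complex attached to a family of maps into a shifted module -/

section Construction

open DerivedCategory

variable {R : Type u} [Ring R] {P : CochainComplex (ModuleCat.{u} R) ℤ} {M : ModuleCat.{u} R}
  {I : Type u} (a : I → (P ⟶ (stalk M)⟦(1 : ℤ)⟧))

variable (M) in
/-- The identification of `M` with the term of `M[1]` in degree `-1`, through `M[1][-1] ≅ M`. -/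
def shiftStalkXIso : ((stalk M)⟦(1 : ℤ)⟧).X (-1) ≅ M :=
  (show ((stalk M)⟦(1 : ℤ)⟧).X (-1) ≅ (stalk M).X 0 from
    (HomologicalComplex.eval (ModuleCat.{u} R) (ComplexShape.up ℤ) 0).mapIso
      (shiftShiftNeg (C := CochainComplex (ModuleCat.{u} R) ℤ) (stalk M) (1 : ℤ))) ≪≫
    HomologicalComplex.singleObjXSelf (ComplexShape.up ℤ) 0 M

lemma isZero_shiftStalk_X {n : ℤ} (hn : n ≠ -1) : IsZero (((stalk M)⟦(1 : ℤ)⟧).X n) :=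
  HomologicalComplex.isZero_single_obj_X (ComplexShape.up ℤ) 0 M (n + 1) (by lia)

/-- The component `(P⁻¹)^(I) ⟶ M` of `ω`. -/
def omegaNegOne : (copower P I).X (-1) ⟶ M :=
  (omega a).f (-1) ≫ (shiftStalkXIso M).hom

lemma mBar_d_zero_one (hP : IsTwoTermProjective P) : (mBar a).d 0 1 = 0 :=
  coneShift_d_zero_one (omega a) (isZero_copower_X (hP.isZero 1 (by lia) (by lia)))
    (isZero_shiftStalk_X (by lia))

/-- The map `(P⁰)^(I) ⟶ H⁰(cone(ω)[-1])`. -/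
def copowerToHomology (hP : IsTwoTermProjective P) :
    (copower P I).X 0 ⟶ (mBar a).homology 0 :=
  coneShiftInl (omega a) ≫ toHomologyZero (mBar a) (mBar_d_zero_one a hP)

/-- The composite `M ≅ H⁰(M) ⟶ H⁰(cone(ω)[-1])`. -/
def homologyPhi : M ⟶ (mBar a).homology 0 :=
  (HomologicalComplex.singleObjHomologySelfIso (ComplexShape.up ℤ) 0 M).inv ≫
    HomologicalComplex.homologyMap (phi a) 0

lemma shiftStalkXIso_hom_homologyPhi (hP : IsTwoTermProjective P) :
    (shiftStalkXIso M).hom ≫ homologyPhi a =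
      coneShiftInr (omega a) ≫ toHomologyZero (mBar a) (mBar_d_zero_one a hP) := by
  have h₁ : (HomologicalComplex.singleObjXSelf (ComplexShape.up ℤ) 0 M).inv ≫ (phi a).f 0 =
      (shiftStalkXIso M).inv ≫ coneShiftInr (omega a) :=
    (Category.assoc _ _ _).symm.trans
      (congrArg ((shiftStalkXIso M).inv ≫ ·) (Category.comp_id _).symm)
  rw [← Iso.eq_inv_comp]
  exact (singleObjHomologySelfIso_inv_homologyMap (mBar_d_zero_one a hP) (phi a)).trans
    ((Category.assoc _ _ _).symm.trans ((congrArg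
      (· ≫ toHomologyZero (mBar a) (mBar_d_zero_one a hP)) h₁).trans (Category.assoc _ _ _)))

/-- `H⁰(cone(ω)[-1])` is the pushout of `M` along the differential `(P⁻¹)^(I) ⟶ (P⁰)^(I)`. -/
lemma isPushout_homology (hP : IsTwoTermProjective P) :
    IsPushout ((copower P I).d (-1) 0) (omegaNegOne a)
      (copowerToHomology a hP) (homologyPhi a) :=
  (isPushout_coneShift_homology (omega a) (isZero_shiftStalk_X (by lia))
    (mBar_d_zero_one a hP)).of_iso (Iso.refl _) (Iso.refl _) (shiftStalkXIso M) (Iso.refl _)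
    (by simp) (by simp [omegaNegOne]) ((Category.comp_id _).trans (Category.id_comp _).symm)
    ((Category.comp_id _).trans (shiftStalkXIso_hom_homologyPhi a hP).symm)

/-- Every morphism `P⁻¹ ⟶ M` is, modulo morphisms that extend to `P⁰`, the composite of `ω` with a
chain map `P ⟶ P^(I)`, if the components of `ω` generate. -/
lemma Generates.exists_eq [HasDerivedCategory.{w} (ModuleCat.{u} R)] {a}
    (ha : Generates a) (hP : IsTwoTermProjective P) (b : P.X (-1) ⟶ M) :
    ∃ (g : P ⟶ copower P I) (k : P.X 0 ⟶ M),
      b = g.f (-1) ≫ omegaNegOne a + P.d (-1) 0 ≫ k := by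
  have := hP.isKProjective
  obtain ⟨φ, hφ⟩ := exists_hom_of_isZero hP (isZero_shiftStalk_X (M := M) (n := 0) (by lia))
    (b ≫ (shiftStalkXIso M).inv)
  have hspan (f : Q.obj P ⟶ Q.obj ((stalk M)⟦(1 : ℤ)⟧)) :
      ∃ g : Q.obj P ⟶ Q.obj (copower P I), g ≫ Q.map (omega a) = f := by
    have hf : f ∈ Submodule.span (End (Q.obj P))ᵐᵒᵖ (Set.range fun i =>
        (Q.map (a i) : Q.obj P ⟶ Q.obj ((stalk M)⟦(1 : ℤ)⟧))) := by
      rw [show Submodule.span _ _ = ⊤ from ha]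
      exact Submodule.mem_top
    induction hf using Submodule.span_induction with
    | mem x hx =>
      obtain ⟨i, rfl⟩ := hx
      exact ⟨Q.map (Sigma.ι (fun _ : I => P) i), by simp [← Functor.map_comp, omega]⟩
    | zero => exact ⟨0, zero_comp⟩
    | add x y _ _ hx hy =>
      obtain ⟨g, rfl⟩ := hx
      obtain ⟨g', rfl⟩ := hy
      exact ⟨g + g', Preadditive.add_comp _ _ _ _ _ _⟩
    | smul r x _ hx =>
      obtain ⟨g, rfl⟩ := hx
      exact ⟨r.unop ≫ g, Category.assoc _ _ _⟩
  obtain ⟨g', hg'⟩ := hspan (Q.map φ)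
  obtain ⟨g, rfl⟩ := Q_map_surjective_of_isKProjective _ _ g'
  have h0 : Q.map (φ - g ≫ omega a) = 0 := by
    rw [Functor.map_sub, Functor.map_comp, hg', sub_self]
  obtain ⟨h⟩ := (Q_map_eq_zero_iff_of_isKProjective _).1 h0
  obtain ⟨k, s, hks⟩ := exists_f_eq_of_homotopy h
  rw [(isZero_shiftStalk_X (M := M) (n := -2) (by lia)).eq_of_tgt s 0, zero_comp, add_zero,
    HomologicalComplex.sub_f_apply, HomologicalComplex.comp_f, hφ, sub_eq_iff_eq_add] at hks
  refine ⟨g, k ≫ (shiftStalkXIso M).hom, ?_⟩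
  rw [(Iso.comp_inv_eq _).1 hks, Preadditive.add_comp, add_comm, omegaNegOne]
  simp only [Category.assoc]

/-- The family of all chain maps `P ⟶ M[1]` generates. -/
lemma generates_id [HasDerivedCategory.{w} (ModuleCat.{u} R)] (hP : IsTwoTermProjective P)
    (M : ModuleCat.{u} R) : Generates fun φ : P ⟶ (stalk M)⟦(1 : ℤ)⟧ => φ := by
  have := hP.isKProjective
  refine top_unique fun f _ => Submodule.subset_span ?_
  exact Q_map_surjective_of_isKProjective _ _ f

end Construction

/-! ### The quotient by a trace -/

section Trace

variable {R : Type u} [Ring R] (N H : ModuleCat.{u} R)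

/-- The quotient map of `H` by the trace of `N`. -/
def traceMkQ : H ⟶ ModuleCat.of R (H ⧸ traceIn N H) :=
  ModuleCat.ofHom (traceIn N H).mkQ

instance : Epi (traceMkQ N H) :=
  (ModuleCat.epi_iff_surjective _).2 (Submodule.mkQ_surjective _)

variable {N H}

@[simp]
lemma comp_traceMkQ (f : N ⟶ H) : f ≫ traceMkQ N H = 0 := by
  ext x
  exact (Submodule.Quotient.mk_eq_zero _).2
    (Submodule.mem_iSup_of_mem (p := fun f : N ⟶ H => LinearMap.range f.hom) f
      (LinearMap.mem_range_self f.hom x))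

lemma exists_traceMkQ_comp_eq {X : ModuleCat.{u} R} (g : H ⟶ X)
    (hg : ∀ f : N ⟶ H, f ≫ g = 0) :
    ∃ k : ModuleCat.of R (H ⧸ traceIn N H) ⟶ X, traceMkQ N H ≫ k = g := by
  refine ⟨ModuleCat.ofHom ((traceIn N H).liftQ g.hom (iSup_le fun f => ?_)), ?_⟩
  · rintro _ ⟨x, rfl⟩
    exact congrArg (fun k : N ⟶ X => k.hom x) (hg f)
  · ext x
    rfl

end Trace

/-! ### The reflection of a module -/

section Reflection

variable {R : Type u} [Ring R] {P : CochainComplex (ModuleCat.{u} R) ℤ} {M : ModuleCat.{u} R}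
  {I : Type u} {a : I → (P ⟶ (stalk M)⟦(1 : ℤ)⟧)}

lemma reflUnit_comp {X : ModuleCat.{u} R} (g : reflObj a ⟶ X) :
    reflUnit a ≫ g =
      homologyPhi a ≫ traceMkQ (P.homology 0) ((mBar a).homology 0) ≫ g :=
  (congrArg (· ≫ g) (Category.assoc _ _ _).symm).trans (Category.assoc _ _ _)

lemma copower_d_ι (n m : ℤ) (i : I) :
    (Sigma.ι (fun _ : I => P) i).f n ≫ (copower P I).d n m =
      P.d n m ≫ (Sigma.ι (fun _ : I => P) i).f m :=
  (Sigma.ι (fun _ : I => P) i).comm n m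

/-- A morphism from `P⁻¹` into the trace of `H⁰(P)` extends to `P⁰`, with values in the trace. -/
lemma SelfOrthogonal.exists_extension_of_comp_traceMkQ_eq_zero
    [HasDerivedCategory.{w} (ModuleCat.{u} R)]
    (horth : SelfOrthogonal P) (hP : IsTwoTermProjective P) {H : ModuleCat.{u} R}
    (f : P.X (-1) ⟶ H) (hf : f ≫ traceMkQ (P.homology 0) H = 0) :
    ∃ k : P.X 0 ⟶ H, P.d (-1) 0 ≫ k = f ∧ k ≫ traceMkQ (P.homology 0) H = 0 := by
  have hP1 : P.d 0 1 = 0 := (hP.isZero 1 (by lia) (by lia)).eq_of_tgt _ _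
  -- The trace is the image of the map `τ` out of a sum of copies of `P⁰`, one for each
  -- homomorphism `H⁰(P) ⟶ H`.
  obtain ⟨τ, hτ⟩ := exists_copower_desc (P := P) (I := P.homology 0 ⟶ H) (n := 0)
    fun j => toHomologyZero P hP1 ≫ j
  have hτq : τ ≫ traceMkQ (P.homology 0) H = 0 := by
    refine copower_hom_ext fun j => ?_
    rw [← Category.assoc, hτ]
    simp
  have hτd : (copower P (P.homology 0 ⟶ H)).d (-1) 0 ≫ τ = 0 := by
    refine copower_hom_ext fun j => ?_
    rw [← Category.assoc, copower_d_ι, Category.assoc, hτ]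
    simp
  have hexact : (ShortComplex.mk τ (traceMkQ (P.homology 0) H) hτq).Exact := by
    rw [ShortComplex.moduleCat_exact_iff_ker_sub_range]
    intro x hx
    have hx' : x ∈ traceIn (P.homology 0) H := (Submodule.Quotient.mk_eq_zero _).1 hx
    refine (iSup_le fun j => ?_ : traceIn (P.homology 0) H ≤ LinearMap.range τ.hom) hx'
    rintro _ ⟨y, rfl⟩
    obtain ⟨z, rfl⟩ := (ModuleCat.epi_iff_surjective (toHomologyZero P hP1)).1 inferInstance y
    exact ⟨_, congrArg (fun k : P.X 0 ⟶ H => k.hom z) (hτ j)⟩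
  have := hP.projective_X
  obtain ⟨β, hβ⟩ : ∃ β, β ≫ τ = f :=
    ⟨hexact.liftFromProjective f hf, hexact.liftFromProjective_comp f hf⟩
  obtain ⟨k, s, rfl⟩ := horth.exists_eq hP _ β
  refine ⟨k ≫ τ, ?_, by rw [Category.assoc, hτq, comp_zero]⟩
  rw [← hβ, Preadditive.add_comp, Category.assoc, Category.assoc, hτd, comp_zero, add_zero]

/-- `H⁰(cone(ω)[-1])` modulo the trace of `H⁰(P)` is perpendicular to `P`. -/
lemma perp_reflObj [HasDerivedCategory.{w} (ModuleCat.{u} R)] (hP : IsTwoTermProjective P)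
    (horth : SelfOrthogonal P) (ha : Generates a) : perp P (reflObj a) := by
  have hproj := hP.projective_X
  have hP1 : P.d 0 1 = 0 := (hP.isZero 1 (by lia) (by lia)).eq_of_tgt _ _
  have hpo := isPushout_homology a hP
  let q : (mBar a).homology 0 ⟶ reflObj a := traceMkQ (P.homology 0) ((mBar a).homology 0)
  have : Epi q := inferInstanceAs (Epi (traceMkQ _ _))
  rw [perp_iff hP]
  constructor
  · suffices h : ∀ u : P.X 0 ⟶ reflObj a, P.d (-1) 0 ≫ u = 0 → u = 0 by
      intro u v huv
      exact sub_eq_zero.1 (h (u - v) (by rw [Preadditive.comp_sub, sub_eq_zero]; exact huv))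
    intro u hu
    obtain ⟨v, rfl⟩ : ∃ v, v ≫ q = u := ⟨Projective.factorThru u q, Projective.factorThru_comp u q⟩
    obtain ⟨k, hk, hkq⟩ := horth.exists_extension_of_comp_traceMkQ_eq_zero hP (P.d (-1) 0 ≫ v)
      ((Category.assoc _ _ _).trans hu)
    -- `v - k` vanishes on the image of the differential, so it factors through `H⁰(P)`.
    obtain ⟨j, hj⟩ := exists_toHomologyZero_comp_eq hP1 (v - k)
      (by rw [Preadditive.comp_sub, hk, sub_self])
    have : (v - k) ≫ q = 0 := by
      rw [← hj, Category.assoc]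
      exact (congrArg (toHomologyZero P hP1 ≫ ·) (comp_traceMkQ j)).trans comp_zero
    rw [Preadditive.sub_comp, sub_eq_zero] at this
    exact this.trans hkq
  · intro f
    have hepi : Epi (biprod.desc (copowerToHomology a hP) (homologyPhi a)) := by
      refine ⟨fun x y hxy => hpo.hom_ext ?_ ?_⟩
      · simpa using biprod.inl ≫= hxy
      · simpa using biprod.inr ≫= hxy
    obtain ⟨g, rfl⟩ : ∃ g, g ≫ q = f := ⟨Projective.factorThru f q, Projective.factorThru_comp f q⟩
    obtain ⟨c, rfl⟩ : ∃ c, c ≫ biprod.desc (copowerToHomology a hP) (homologyPhi a) = g :=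
      ⟨Projective.factorThru g _, Projective.factorThru_comp g _⟩
    -- Modulo morphisms extending to `P⁰`, the component of `c` in `(P⁰)^(I)` comes from
    -- `(P⁻¹)^(I)`, hence can be moved to `M`, where generation applies.
    obtain ⟨k, s, hks⟩ := horth.exists_eq hP I (c ≫ biprod.fst)
    obtain ⟨e, l, hel⟩ := ha.exists_eq hP (s ≫ omegaNegOne a + c ≫ biprod.snd)
    refine ⟨(k ≫ copowerToHomology a hP + e.f 0 ≫ copowerToHomology a hP +
      l ≫ homologyPhi a) ≫ q, ?_⟩
    have h : c ≫ biprod.desc (copowerToHomology a hP) (homologyPhi a) =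
        (c ≫ biprod.fst) ≫ copowerToHomology a hP + (c ≫ biprod.snd) ≫ homologyPhi a := by
      rw [biprod.desc_eq, Preadditive.comp_add, Category.assoc, Category.assoc]
    have h₂ := hel =≫ homologyPhi a
    simp only [Preadditive.add_comp, Category.assoc, ← hpo.w] at h₂
    rw [h, hks]
    simp only [← Category.assoc]
    congr 1
    simp only [Preadditive.add_comp, Preadditive.comp_add, Category.assoc, add_assoc, h₂]
    rw [← HomologicalComplex.Hom.comm_assoc]

/-- The canonical map `M ⟶ reflObj a` is universal among the maps from `M` to a module
perpendicular to `P`. -/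
lemma existsUnique_reflUnit_comp_eq [HasDerivedCategory.{w} (ModuleCat.{u} R)]
    (hP : IsTwoTermProjective P) (a : I → (P ⟶ (stalk M)⟦(1 : ℤ)⟧)) {X : ModuleCat.{u} R}
    (hX : perp P X) (f : M ⟶ X) : ∃! g : reflObj a ⟶ X, reflUnit a ≫ g = f := by
  have hP1 : P.d 0 1 = 0 := (hP.isZero 1 (by lia) (by lia)).eq_of_tgt _ _
  have hpo := isPushout_homology a hP
  obtain ⟨hinj, hsurj⟩ := (perp_iff hP X).1 hX
  apply existsUnique_of_exists_of_unique
  · choose c hc using fun i =>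
      hsurj ((Sigma.ι (fun _ : I => P) i).f (-1) ≫ omegaNegOne a ≫ f)
    obtain ⟨c', hc'⟩ := exists_copower_desc c
    have hw : (copower P I).d (-1) 0 ≫ c' = omegaNegOne a ≫ f := by
      refine copower_hom_ext fun i => ?_
      rw [← Category.assoc, copower_d_ι, Category.assoc, hc']
      exact hc i
    obtain ⟨g, hg⟩ := exists_traceMkQ_comp_eq (N := P.homology 0) (hpo.desc c' f hw) (by
      intro j
      rw [← cancel_epi (toHomologyZero P hP1)]
      exact hinj (by simp))
    refine ⟨g, ?_⟩
    exact (reflUnit_comp g).trans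
      ((congrArg (homologyPhi a ≫ ·) hg).trans (hpo.inr_desc _ _ _))
  · intro g₁ g₂ h₁ h₂
    have h : homologyPhi a ≫ traceMkQ (P.homology 0) ((mBar a).homology 0) ≫ g₁ =
        homologyPhi a ≫ traceMkQ (P.homology 0) ((mBar a).homology 0) ≫ g₂ :=
      (reflUnit_comp g₁).symm.trans (h₁.trans (h₂.symm.trans (reflUnit_comp g₂)))
    refine (cancel_epi (traceMkQ (P.homology 0) ((mBar a).homology 0))).1 ?_
    refine hpo.hom_ext (copower_hom_ext fun i => hinj ?_) h
    have := (Sigma.ι (fun _ : I => P) i).f (-1) ≫= omegaNegOne a ≫= h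
    rw [← hpo.w_assoc, ← hpo.w_assoc] at this
    simpa [reassoc_of% (copower_d_ι (P := P) (I := I))] using this

end Reflection

/-! ### Uniqueness of units -/

section Adjunction

universe v₁ v₂ u₁ u₂

/-- The unit of an adjunction is determined up to isomorphism by its universal property. -/
lemma exists_iso_of_adjunction {C : Type u₁} [Category.{v₁} C] {Z : ObjectProperty C}
    {l : C ⥤ Z.FullSubcategory} (adj : l ⊣ Z.ι) {M Y : C} (hY : Z Y) (η : M ⟶ Y)
    (hη : ∀ (X : C) (_ : Z X) (f : M ⟶ X), ∃! g : Y ⟶ X, η ≫ g = f) :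
    ∃ e : (l.obj M).obj ≅ Y, adj.unit.app M ≫ e.hom = η := by
  obtain ⟨g, hg, -⟩ := hη _ (l.obj M).property (adj.unit.app M)
  let h : l.obj M ⟶ ⟨Y, hY⟩ := (adj.homEquiv M ⟨Y, hY⟩).symm η
  have hh : adj.unit.app M ≫ Z.ι.map h = η := by
    exact (adj.homEquiv_unit _ _ h).symm.trans ((adj.homEquiv M ⟨Y, hY⟩).apply_symm_apply η)
  refine ⟨⟨Z.ι.map h, g, ?_, (hη Y hY η).unique ?_ (Category.comp_id _)⟩, hh⟩
  · have : h ≫ Z.homMk g = 𝟙 (l.obj M) := by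
      apply (adj.homEquiv _ _).injective
      rw [adj.homEquiv_unit, adj.homEquiv_unit, Functor.map_comp, ← Category.assoc, hh]
      exact hg.trans (by simp)
    exact congrArg Z.ι.map this
  · rw [← Category.assoc, hg, hh]

end Adjunction

end TwoTermPerp

end

theorem proposition3p9 {R : Type u} [Ring R] [HasDerivedCategory.{w} (ModuleCat.{u} R)]
    (P : CochainComplex (ModuleCat.{u} R) ℤ)
    (hP : TwoTermPerp.IsTwoTermProjective P)
    (horth : TwoTermPerp.SelfOrthogonal P) :
    ∃ (l : ModuleCat.{u} R ⥤ (TwoTermPerp.perp P).FullSubcategory)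
      (adj : l ⊣ (TwoTermPerp.perp P).ι),
      ∀ M : ModuleCat.{u} R,
        (∃ (I : Type u) (a : I → (P ⟶ (TwoTermPerp.stalk M)⟦(1 : ℤ)⟧)),
          TwoTermPerp.Generates a) ∧
        ∀ (I : Type u) (a : I → (P ⟶ (TwoTermPerp.stalk M)⟦(1 : ℤ)⟧)),
          TwoTermPerp.Generates a →
            ∃ e : (l.obj M).obj ≅ TwoTermPerp.reflObj a,
              adj.unit.app M ≫ e.hom = TwoTermPerp.reflUnit a := by
  have : (TwoTermPerp.perp P).ι.IsRightAdjoint := by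
    have (M : ModuleCat.{u} R) : HasInitial (StructuredArrow M (TwoTermPerp.perp P).ι) := by
      have hgen := TwoTermPerp.generates_id hP M
      have huniv (X : (TwoTermPerp.perp P).FullSubcategory) :=
        TwoTermPerp.existsUnique_reflUnit_comp_eq hP
          (fun φ : P ⟶ (TwoTermPerp.stalk M)⟦(1 : ℤ)⟧ => φ) X.property
      exact (IsInitial.ofUniqueHom (X := StructuredArrow.mk
        (Y := (⟨_, TwoTermPerp.perp_reflObj hP horth hgen⟩ :
          (TwoTermPerp.perp P).FullSubcategory)) (TwoTermPerp.reflUnit _))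
        (fun Y => StructuredArrow.homMk (ObjectProperty.homMk (huniv Y.right Y.hom).choose)
          (huniv Y.right Y.hom).choose_spec.1)
        (fun Y m => StructuredArrow.ext _ _ (ObjectProperty.hom_ext _
          ((huniv Y.right Y.hom).choose_spec.2 _ (StructuredArrow.w m))))).hasInitial
    exact isRightAdjointOfStructuredArrowInitials _
  refine ⟨_, Adjunction.ofIsRightAdjoint (TwoTermPerp.perp P).ι, fun M =>
    ⟨⟨_, _, TwoTermPerp.generates_id hP M⟩, fun I a ha => ?_⟩⟩
  exact TwoTermPerp.exists_iso_of_adjunction _ (TwoTermPerp.perp_reflObj hP horth ha)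
    (TwoTermPerp.reflUnit a) fun X hX f => TwoTermPerp.existsUnique_reflUnit_comp_eq hP a hX f
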